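/- Let $[n]=\{1,\dots,n\}$. Write each set partition $\Pi$ of $[n]$ in standard increasing form (entries increasing within each block, blocks arranged in increasing order of their first entries), and let $\mathrm{Flatten}(\Pi)$ be the permutation of $[n]$ obtained by erasing the dividers between the blocks. Let $\mathcal U(n;231)$ be the set of partitions $\Pi$ of $[n]$ such that $\mathrm{Flatten}(\Pi)$ avoids the pattern $231$ in the classical sense. A descent terminator of a permutation is an entry that is smaller than its immediate predecessor; by convention the first entry is also a descent terminator. A right-to-left minimum is an entry smaller than all the entries after it. Let $\mathcal U(n,k;231)$ be the set of $\Pi\in\mathcal U(n;231)$ for which exactly $k$ right-to-left minima of $\mathrm{Flatten}(\Pi)$ are not descent terminators. Let $C_m$ be the $m$-th Catalan number, with $C_x:=0$ if $x$ is not an integer. Then, for all integers $n\ge 1$ and $k\ge 0$, $$|\mathcal U(n,k;231)|=\binom{n-1}{k}\,2^k\,C_{\frac{n-1-k}{2}},$$ where the right-hand side is $0$ when $k\ge n$; and, for all $n\ge 0$, $$|\mathcal U(n;231)|=C_n .$$ -/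

import Mathlib

namespace FlattenPartition

/-- The block initiators of a partition of `[n] = {1, …, n}`: the elements that are the smallest
entry of their block. -/
def blockInitiators {n : ℕ} (P : Finpartition (Finset.Icc 1 n)) : Finset ℕ :=
  (Finset.Icc 1 n).filter fun a => ∀ b ∈ P.part a, a ≤ b

/-- The standard increasing form of a partition of `[n]`: each block is listed increasingly, and
the blocks are arranged in increasing order of their first entries. -/
def standardForm {n : ℕ} (P : Finpartition (Finset.Icc 1 n)) : List (List ℕ) :=
  (blockInitiators P).sort.map fun a => (P.part a).sort

/-- The flattening of a partition of `[n]`: erase the dividers in its standard increasing form.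
The result is a permutation of `[n]` in one-line notation. -/
def flatten {n : ℕ} (P : Finpartition (Finset.Icc 1 n)) : List ℕ :=
  (standardForm P).flatten

/-- The word `w` contains the pattern `p` (in the classical sense): some subsequence of `w`, at
the strictly increasing positions `f 0 < f 1 < …`, is order isomorphic to `p`. -/
def ContainsPattern (w p : List ℕ) : Prop :=
  ∃ f : Fin p.length → Fin w.length, StrictMono f ∧
    ∀ i j : Fin p.length, w.get (f i) < w.get (f j) ↔ p.get i < p.get j

/-- The partitions of `[n]` whose flattening avoids the pattern `p`. -/
def avoiders (n : ℕ) (p : List ℕ) : Set (Finpartition (Finset.Icc 1 n)) :=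
  {P | ¬ ContainsPattern (flatten P) p}

/-- The descent terminators of a word: the entries smaller than their immediate predecessor and,
by convention, the first entry. -/
def descentTerminators (w : List ℕ) : Set ℕ :=
  {x | ∃ i : Fin w.length, w.get i = x ∧
    ((i : ℕ) = 0 ∨ ∃ j : Fin w.length, (j : ℕ) + 1 = i ∧ w.get i < w.get j)}

/-- The right-to-left minima of a word: the entries smaller than all the entries after them. -/
def rightToLeftMinima (w : List ℕ) : Set ℕ :=
  {x | ∃ i : Fin w.length, w.get i = x ∧ ∀ j : Fin w.length, i < j → w.get i < w.get j}

/-- The right-to-left minima of the flattening of `P` that are not descent terminators. -/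
def nonDescentMinima {n : ℕ} (P : Finpartition (Finset.Icc 1 n)) : Set ℕ :=
  rightToLeftMinima (flatten P) \ descentTerminators (flatten P)

/-- The partitions of `[n]` whose flattening avoids `p` and has exactly `k` right-to-left minima
that are not descent terminators. -/
def refinedAvoiders (n k : ℕ) (p : List ℕ) : Set (Finpartition (Finset.Icc 1 n)) :=
  {P | P ∈ avoiders n p ∧ (nonDescentMinima P).ncard = k}

/-- The Catalan number `C_{m/2}`, with the convention that it is `0` when `m/2` is not an
integer. -/
def catalanHalf (m : ℕ) : ℕ := if Even m then catalan (m / 2) else 0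

end FlattenPartition

/-!
A partition of `[n]` amounts to its flattening `w` together with the set `S` of its block
initiators. Every initiator is smaller than all later letters of `w`, and every descent terminator
opens a block; so `S` lies between the descent terminators and the right-to-left minima of `w`.
Conversely, cutting a permutation `w` before the letters of any such `S` gives the standard form of
a partition (`exists_flatten_eq`, `flatten_blockInitiators_injective`). Hence a permutation `w` is a
flattening exactly when its descent terminators are right-to-left minima, and it then comes from
`2 ^ k` partitions, where `k` is the number of right-to-left minima that are not descent terminators
(`ncard_partitions`).

It remains to count the 231-avoiding flattenings by `k`. Write such a word, of length at least `2`,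
as `u m v` with `m` its greatest letter. Avoidance of 231 puts the letters of `u` below those of
`v`; then `u` and `v` (standardised) are again 231-avoiding flattenings, `u` is nonempty, and any
such `u` and `v` may occur (`glue_mem_flatWords`, `exists_eq_glue`). The statistic is additive,
except that `m` itself counts when `v` is empty (`freeMinima_glue`). This is the first-step
recursion of Motzkin paths of length `n - 1` by level steps, which `(m choose k) * C_{(m - k) / 2}`
satisfies as well (`motzkin_add_two`), by the Catalan recursion and the convolution of powers of
`1 / (1 - X)`. Setting `X = 2`, the recursion becomes that of the Catalan numbers
(`eval_motzkin`), which gives the second count.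
-/

namespace FlattenPartition

/-! ### Words: minima, descents and the pattern 231 -/

lemma mem_rightToLeftMinima {w : List ℕ} {x : ℕ} :
    x ∈ rightToLeftMinima w ↔ ∃ u v, w = u ++ x :: v ∧ ∀ y ∈ v, x < y := by
  constructor
  · rintro ⟨i, rfl, hi⟩
    refine ⟨w.take i, w.drop (i + 1), by simp, fun y hy => ?_⟩
    obtain ⟨j, hj, rfl⟩ := List.mem_drop_iff_getElem.1 hy
    exact hi ⟨i + 1 + j, by omega⟩ (Fin.lt_def.2 (by simp only; omega))
  · rintro ⟨u, v, rfl, h⟩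
    refine ⟨⟨u.length, by simp⟩, by simp, fun j hj => ?_⟩
    have hj' : u.length < (j : ℕ) := hj
    simp only [List.get_eq_getElem, List.getElem_append_right le_rfl, Nat.sub_self,
      List.getElem_cons_zero]
    apply h
    rw [List.getElem_append_right hj'.le]
    obtain ⟨m, hm⟩ : ∃ m, (j : ℕ) - u.length = m + 1 := ⟨j - u.length - 1, by omega⟩
    simp only [hm, List.getElem_cons_succ]
    exact List.getElem_mem _

/-- The condition on `u.getLast?` is void for empty `u`, as the convention on the first letter asks. -/
lemma mem_descentTerminators {w : List ℕ} {x : ℕ} :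
    x ∈ descentTerminators w ↔ ∃ u v, w = u ++ x :: v ∧ ∀ y ∈ u.getLast?, x < y := by
  constructor
  · rintro ⟨i, rfl, hi⟩
    refine ⟨w.take i, w.drop (i + 1), by simp, fun y hy => ?_⟩
    rcases hi with hi | ⟨j, hj, hlt⟩
    · simp [hi] at hy
    · have : (i : ℕ) - 1 = j := by omega
      have h0 : (i : ℕ) ≠ 0 := by omega
      have : w[(j : ℕ)]? = some w[(j : ℕ)] := List.getElem?_eq_getElem j.2
      simp_all [List.getLast?_take]
  · rintro ⟨u, v, rfl, h⟩
    refine ⟨⟨u.length, by simp⟩, by simp, ?_⟩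
    rcases List.eq_nil_or_concat u with rfl | ⟨u, y, rfl⟩
    · simp
    · refine Or.inr ⟨⟨u.length, by simp⟩, by simp, ?_⟩
      simpa using h

/-- The word `w` has no subsequence `a, b, c` with `c < a < b`. -/
def Avoids231 (w : List ℕ) : Prop :=
  ∀ a b c, [a, b, c].Sublist w → c < a → b ≤ a

lemma not_containsPattern_iff {w : List ℕ} :
    ¬ ContainsPattern w [2, 3, 1] ↔ Avoids231 w := by
  rw [← not_iff_not, not_not]
  constructor
  · rintro ⟨f, hf, h⟩ hw
    have := hw (w.get (f 0)) (w.get (f 1)) (w.get (f 2)) ?_ ?_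
    · have h01 : w.get (f 0) < w.get (f 1) := (h 0 1).2 (by decide)
      omega
    · rw [List.sublist_iff_exists_fin_orderEmbedding_get_eq]
      refine ⟨OrderEmbedding.ofStrictMono f hf, fun i => ?_⟩
      fin_cases i <;> rfl
    · exact (h 2 0).2 (by decide)
  · intro hw
    simp only [Avoids231] at hw
    push Not at hw
    obtain ⟨a, b, c, hs, hca, hab⟩ := hw
    rw [List.sublist_iff_exists_fin_orderEmbedding_get_eq] at hs
    obtain ⟨f, hf⟩ := hs
    refine ⟨f, f.strictMono, fun i j => ?_⟩
    have h0 : a = w.get (f 0) := hf 0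
    have h1 : b = w.get (f 1) := hf 1
    have h2 : c = w.get (f 2) := hf 2
    fin_cases i <;> fin_cases j <;> simp <;> simp at h0 h1 h2 <;> omega

/-- In a word with greatest letter `m`, avoidance of 231 can be tested on the two sides of `m`,
and no letter before `m` exceeds a letter after `m`. -/
lemma avoids231_append_cons {u v : List ℕ} {m : ℕ} (hu : ∀ x ∈ u, x < m) (hv : ∀ x ∈ v, x < m) :
    Avoids231 (u ++ m :: v) ↔
      Avoids231 u ∧ Avoids231 v ∧ ∀ x ∈ u, ∀ y ∈ v, x ≤ y := by
  constructor
  · intro h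
    refine ⟨fun a b c hs => h a b c (hs.trans (List.sublist_append_left _ _)),
      fun a b c hs => h a b c (hs.trans ((List.sublist_cons_self _ _).trans
        (List.sublist_append_right _ _))), fun x hx y hy => ?_⟩
    by_contra hlt
    have := h x m y (List.Sublist.append (l₁ := [x]) (List.singleton_sublist.2 hx)
      (List.Sublist.cons_cons m (List.singleton_sublist.2 hy))) (by omega)
    have := hu x hx
    omega
  · rintro ⟨h1, h2, h3⟩ a b c hs hca
    obtain ⟨l₁, l₂, he, hl₁, hl₂⟩ := List.sublist_append_iff.1 hs
    rcases l₁ with _ | ⟨a', _ | ⟨b', _ | ⟨c', l₁⟩⟩⟩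
    · simp only [List.nil_append] at he
      subst he
      rcases List.sublist_cons_iff.1 hl₂ with hl | ⟨r, hr, hl⟩
      · exact h2 a b c hl hca
      · obtain ⟨rfl, rfl⟩ := List.cons.inj hr
        exact (hv b (hl.subset (by simp))).le
    · simp only [List.cons_append, List.nil_append, List.cons.injEq] at he
      obtain ⟨rfl, rfl⟩ := he
      have ha := hl₁.subset (List.mem_singleton_self a)
      have hc : c ∈ v := by
        rcases List.sublist_cons_iff.1 hl₂ with hl | ⟨r, hr, hl⟩
        · exact hl.subset (by simp)
        · obtain ⟨rfl, rfl⟩ := List.cons.inj hr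
          exact hl.subset (by simp)
      have := h3 a ha c hc
      omega
    · simp only [List.cons_append, List.nil_append, List.cons.injEq] at he
      obtain ⟨rfl, rfl, rfl⟩ := he
      have ha := hu a (hl₁.subset (by simp))
      have ha' : a ∈ u := hl₁.subset (by simp)
      rcases List.mem_cons.1 (List.singleton_sublist.1 hl₂) with rfl | hc
      · omega
      · have := h3 a ha' c hc
        omega
    · have hlen := congrArg List.length he
      simp only [List.length_cons, List.length_append, List.length_nil] at hlen
      obtain rfl : l₁ = [] := List.length_eq_zero_iff.1 (by omega)
      obtain rfl : l₂ = [] := List.length_eq_zero_iff.1 (by omega)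
      rw [List.append_nil] at he
      exact h1 a b c (he ▸ hl₁) hca

lemma avoids231_map {w : List ℕ} {f : ℕ → ℕ} (hf : StrictMono f) :
    Avoids231 (w.map f) ↔ Avoids231 w := by
  constructor
  · intro h a b c hs hca
    exact hf.le_iff_le.1 (h _ _ _ (hs.map f) (hf hca))
  · intro h a b c hs hca
    obtain ⟨l, hl, he⟩ := List.sublist_map_iff.1 hs
    obtain ⟨a', l, rfl, rfl, hb⟩ := List.map_eq_cons_iff.1 he.symm
    obtain ⟨b', l, rfl, rfl, hc⟩ := List.map_eq_cons_iff.1 hb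
    obtain ⟨c', l, rfl, rfl, hn⟩ := List.map_eq_cons_iff.1 hc
    obtain rfl := List.map_eq_nil_iff.1 hn
    exact hf.monotone (h _ _ _ hl (hf.lt_iff_lt.1 hca))

lemma mem_of_mem_rightToLeftMinima {w : List ℕ} {x : ℕ} (h : x ∈ rightToLeftMinima w) : x ∈ w := by
  obtain ⟨u, v, rfl, -⟩ := mem_rightToLeftMinima.1 h
  simp

lemma mem_of_mem_descentTerminators {w : List ℕ} {x : ℕ} (h : x ∈ descentTerminators w) :
    x ∈ w := by
  obtain ⟨u, v, rfl, -⟩ := mem_descentTerminators.1 h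
  simp

lemma mem_rightToLeftMinima_append {u v : List ℕ} {x : ℕ} :
    x ∈ rightToLeftMinima (u ++ v) ↔
      (x ∈ rightToLeftMinima u ∧ ∀ y ∈ v, x < y) ∨ x ∈ rightToLeftMinima v := by
  simp only [mem_rightToLeftMinima]
  constructor
  · rintro ⟨p, q, he, h⟩
    rcases List.append_eq_append_iff.1 he with ⟨r, rfl, hv⟩ | ⟨r, rfl, hq⟩
    · exact Or.inr ⟨r, q, hv, h⟩
    · rcases List.cons_eq_append_iff.1 hq with ⟨rfl, rfl⟩ | ⟨r, rfl, rfl⟩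
      · exact Or.inr ⟨[], q, rfl, h⟩
      · exact Or.inl ⟨⟨p, r, rfl, fun y hy => h y (by simp [hy])⟩, fun y hy => h y (by simp [hy])⟩
  · rintro (⟨⟨p, q, rfl, h⟩, h'⟩ | ⟨p, q, rfl, h⟩)
    · exact ⟨p, q ++ v, by simp, fun y hy => (List.mem_append.1 hy).elim (h y) (h' y)⟩
    · exact ⟨u ++ p, q, by simp, h⟩

lemma mem_rightToLeftMinima_cons {a : ℕ} {v : List ℕ} {x : ℕ} :
    x ∈ rightToLeftMinima (a :: v) ↔ (x = a ∧ ∀ y ∈ v, a < y) ∨ x ∈ rightToLeftMinima v := by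
  have h : x ∈ rightToLeftMinima [a] ↔ x = a := by
    rw [mem_rightToLeftMinima]
    constructor
    · rintro ⟨u, v, he, -⟩
      have : x ∈ [a] := by simp [he]
      simpa using this
    · rintro rfl
      exact ⟨[], [], rfl, by simp⟩
  rw [← List.singleton_append, mem_rightToLeftMinima_append, h]
  constructor
  · rintro (⟨rfl, hv⟩ | hv)
    exacts [Or.inl ⟨rfl, hv⟩, Or.inr hv]
  · rintro (⟨rfl, hv⟩ | hv)
    exacts [Or.inl ⟨rfl, hv⟩, Or.inr hv]

/-- The greatest letter `m`, unless it comes first, is not a descent terminator, while the letter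
after it is one, in agreement with the convention for the first letter of `v`. -/
lemma mem_descentTerminators_append_cons {u v : List ℕ} {m x : ℕ} (hu : ∀ y ∈ u, y < m)
    (hv : ∀ y ∈ v, y < m) (hne : u ≠ []) :
    x ∈ descentTerminators (u ++ m :: v) ↔
      x ∈ descentTerminators u ∨ x ∈ descentTerminators v := by
  simp only [mem_descentTerminators]
  constructor
  · rintro ⟨p, q, he, h⟩
    rcases List.append_eq_append_iff.1 he with ⟨r, rfl, hr⟩ | ⟨r, rfl, hq⟩
    · rcases List.cons_eq_append_iff.1 hr with ⟨rfl, hr⟩ | ⟨r, rfl, rfl⟩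
      · obtain ⟨rfl, rfl⟩ := List.cons.inj hr
        rw [List.append_nil] at h
        have := h _ (List.getLast?_eq_getLast_of_ne_nil hne)
        have := hu _ (List.getLast_mem hne)
        omega
      · refine Or.inr ⟨r, q, rfl, fun y hy => h y ?_⟩
        simp only [Option.mem_def] at hy
        simp [List.getLast?_append, List.getLast?_cons, hy]
    · rcases List.cons_eq_append_iff.1 hq with ⟨rfl, hr⟩ | ⟨r, rfl, rfl⟩
      · obtain ⟨rfl, rfl⟩ := List.cons.inj hr
        rw [List.append_nil] at hne hu
        have := h _ (List.getLast?_eq_getLast_of_ne_nil hne)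
        have := hu _ (List.getLast_mem hne)
        omega
      · exact Or.inl ⟨p, r, rfl, h⟩
  · rintro (⟨p, q, rfl, h⟩ | ⟨p, q, rfl, h⟩)
    · exact ⟨p, q ++ m :: v, by simp, h⟩
    · refine ⟨u ++ m :: p, q, by simp, fun y hy => ?_⟩
      have hx := hv x (by simp)
      rcases hp : p.getLast? with _ | z
      · simp [List.getLast?_append, List.getLast?_cons, hp] at hy
        omega
      · simp [List.getLast?_append, List.getLast?_cons, hp] at hy
        exact h y (by simp [hp, hy])

lemma rightToLeftMinima_map {w : List ℕ} {f : ℕ → ℕ} (hf : StrictMono f) :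
    rightToLeftMinima (w.map f) = f '' rightToLeftMinima w := by
  ext x
  simp only [Set.mem_image, mem_rightToLeftMinima]
  constructor
  · rintro ⟨u, v, he, h⟩
    obtain ⟨u', v', rfl, rfl, hv⟩ := List.map_eq_append_iff.1 he
    obtain ⟨x', v', rfl, rfl, rfl⟩ := List.map_eq_cons_iff.1 hv
    exact ⟨x', ⟨u', v', rfl, fun y hy => hf.lt_iff_lt.1 (h _ (List.mem_map_of_mem hy))⟩, rfl⟩
  · rintro ⟨x, ⟨u, v, rfl, h⟩, rfl⟩
    refine ⟨u.map f, v.map f, by simp, fun y hy => ?_⟩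
    obtain ⟨z, hz, rfl⟩ := List.mem_map.1 hy
    exact hf (h z hz)

lemma descentTerminators_map {w : List ℕ} {f : ℕ → ℕ} (hf : StrictMono f) :
    descentTerminators (w.map f) = f '' descentTerminators w := by
  ext x
  simp only [Set.mem_image, mem_descentTerminators]
  constructor
  · rintro ⟨u, v, he, h⟩
    obtain ⟨u', v', rfl, rfl, hv⟩ := List.map_eq_append_iff.1 he
    obtain ⟨x', v', rfl, rfl, rfl⟩ := List.map_eq_cons_iff.1 hv
    refine ⟨x', ⟨u', v', rfl, fun y hy => hf.lt_iff_lt.1 (h _ ?_)⟩, rfl⟩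
    simp only [Option.mem_def] at hy
    simp [List.getLast?_map, hy]
  · rintro ⟨x, ⟨u, v, rfl, h⟩, rfl⟩
    refine ⟨u.map f, v.map f, by simp, fun y hy => ?_⟩
    rw [List.getLast?_map, Option.mem_def, Option.map_eq_some_iff] at hy
    obtain ⟨z, hz, rfl⟩ := hy
    exact hf (h z hz)

end FlattenPartition

namespace FlattenPartition

/-! ### Partitions as words with marked letters -/

/-- A list of blocks in standard increasing form. The blocks are nonempty, so that `headI` is their
first entry and its default value `0` plays no role. -/
def IsStandard (m : List (List ℕ)) : Prop :=
  (∀ l ∈ m, l ≠ [] ∧ l.Pairwise (· < ·)) ∧ m.Pairwise fun l l' => l.headI < l'.headI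

lemma eq_of_mem_of_nodup_flatten {m : List (List ℕ)} (hm : m.flatten.Nodup) {l l' : List ℕ}
    (hl : l ∈ m) (hl' : l' ∈ m) {x : ℕ} (hx : x ∈ l) (hx' : x ∈ l') : l = l' := by
  by_contra hne
  have h := (List.nodup_flatten.1 hm).2
  have : Std.Symm (α := List ℕ) List.Disjoint := ⟨fun _ _ h => h.symm⟩
  exact h.forall hl hl' hne hx hx'

lemma headI_le_of_mem {l : List ℕ} (hl : l.Pairwise (· < ·)) {x : ℕ} (hx : x ∈ l) :
    l.headI ≤ x := by
  cases l with
  | nil => simp at hx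
  | cons a l =>
    rcases List.mem_cons.1 hx with rfl | h
    · exact le_rfl
    · exact ((List.pairwise_cons.1 hl).1 x h).le

lemma headI_mem {l : List ℕ} (hl : l ≠ []) : l.headI ∈ l := by
  cases l with
  | nil => exact absurd rfl hl
  | cons a l => simp

lemma IsStandard.heads_subset_rightToLeftMinima {m : List (List ℕ)} (hm : IsStandard m) :
    ∀ x ∈ m.map List.headI, x ∈ rightToLeftMinima m.flatten := by
  intro x hx
  obtain ⟨l, hl, rfl⟩ := List.mem_map.1 hx
  obtain ⟨m₁, m₂, rfl⟩ := List.append_of_mem hl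
  rw [mem_rightToLeftMinima]
  obtain ⟨hne, hs⟩ := hm.1 l hl
  obtain ⟨a, t, rfl⟩ := List.exists_cons_of_ne_nil hne
  refine ⟨m₁.flatten, t ++ m₂.flatten, by simp, fun y hy => ?_⟩
  rcases List.mem_append.1 hy with h | h
  · exact (List.pairwise_cons.1 hs).1 y h
  · obtain ⟨l', hl', hy'⟩ := List.mem_flatten.1 h
    have h1 := (List.pairwise_cons.1 (List.pairwise_append.1 hm.2).2.1).1 l' hl'
    exact h1.trans_le (headI_le_of_mem (hm.1 l' (by simp [hl'])).2 hy')

lemma IsStandard.descentTerminators_subset_heads {m : List (List ℕ)} (hm : IsStandard m)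
    (hn : m.flatten.Nodup) : ∀ x ∈ descentTerminators m.flatten, x ∈ m.map List.headI := by
  intro x hx
  obtain ⟨l, hl, hxl⟩ := List.mem_flatten.1 (mem_of_mem_descentTerminators hx)
  obtain ⟨p, q, he, h⟩ := mem_descentTerminators.1 hx
  refine List.mem_map.2 ⟨l, hl, ?_⟩
  obtain ⟨m₁, m₂, rfl⟩ := List.append_of_mem hl
  obtain ⟨r, s, rfl⟩ := List.append_of_mem hxl
  rcases List.eq_nil_or_concat r with rfl | ⟨r, z, rfl⟩
  · simp
  · exfalso
    have he' : m₁.flatten ++ r.concat z ++ x :: (s ++ m₂.flatten) = p ++ x :: q := by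
      simpa using he
    have hn' : (m₁.flatten ++ r.concat z ++ x :: (s ++ m₂.flatten)).Nodup := by simpa using hn
    have hx1 : x ∉ m₁.flatten ++ r.concat z := fun hx => by
      exact (List.disjoint_of_nodup_append hn') hx (by simp)
    have hx2 : x ∉ s ++ m₂.flatten := (List.nodup_cons.1 (List.nodup_append.1 hn').2.1).1
    have hp : m₁.flatten ++ r.concat z = p := ((List.append_cons_inj_of_notMem hx1 hx2).1 he').1
    have h1 : x < z := h z (by simp [← hp])
    have h2 := (hm.1 _ hl).2
    have h3 : z < x := (List.pairwise_append.1 h2).2.2 z (by simp) x (by simp)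
    omega

/-- The blocks of a standard form are recovered by cutting its flattening before each block
initiator. -/
lemma IsStandard.splitBy_flatten {m : List (List ℕ)} (hm : IsStandard m) (hn : m.flatten.Nodup)
    {S : Finset ℕ} (hS : ∀ x, x ∈ S ↔ x ∈ m.map List.headI) :
    m.flatten.splitBy (fun _ b => decide (b ∉ S)) = m := by
  refine List.splitBy_flatten (fun h => (hm.1 _ h).1 rfl) (fun l hl => ?_) ?_
  · refine List.Pairwise.isChain ?_
    obtain ⟨a, t, rfl⟩ := List.exists_cons_of_ne_nil (hm.1 l hl).1
    have ht : ∀ y ∈ t, y ∉ S := by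
      intro y hy hyS
      obtain ⟨l', hl', rfl⟩ := List.mem_map.1 ((hS y).1 hyS)
      have := eq_of_mem_of_nodup_flatten hn hl hl' (List.mem_cons_of_mem a hy)
        (headI_mem (hm.1 l' hl').1)
      subst this
      have := (List.pairwise_cons.1 (hm.1 _ hl).2).1 _ hy
      simp at this
    refine List.pairwise_cons.2 ⟨fun y hy => by simpa using ht y hy, ?_⟩
    exact List.pairwise_of_forall_mem_list fun x _ y hy => by simpa using ht y hy
  · refine List.Pairwise.isChain (List.pairwise_of_forall_mem_list fun l hl l' hl' => ?_)
    refine ⟨(hm.1 l hl).1, (hm.1 l' hl').1, ?_⟩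
    obtain ⟨a, t, rfl⟩ := List.exists_cons_of_ne_nil (hm.1 l' hl').1
    exact decide_eq_false (not_not.2 ((hS a).2 (List.mem_map.2 ⟨_, hl', rfl⟩)))

section Partition

variable {n : ℕ} (P : Finpartition (Finset.Icc 1 n))

lemma mem_blockInitiators {a : ℕ} :
    a ∈ blockInitiators P ↔ a ∈ Finset.Icc 1 n ∧ ∀ b ∈ P.part a, a ≤ b := by
  rw [blockInitiators, Finset.mem_filter]

lemma headI_sort {s : Finset ℕ} {a : ℕ} (ha : a ∈ s) (h : ∀ b ∈ s, a ≤ b) :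
    s.sort.headI = a := by
  have hs : s.sort.Pairwise (· < ·) := (Finset.sortedLT_sort s).pairwise
  have h1 : s.sort.headI ≤ a := headI_le_of_mem hs ((Finset.mem_sort _).2 ha)
  have hne : s.sort ≠ [] := by
    intro h0
    have := (Finset.mem_sort (· ≤ ·)).2 ha
    simp [h0] at this
  exact h1.antisymm (h _ ((Finset.mem_sort _).1 (headI_mem hne)))

lemma map_headI_standardForm : (standardForm P).map List.headI = (blockInitiators P).sort := by
  rw [standardForm, List.map_map]
  refine (List.map_congr_left fun a ha => ?_).trans (List.map_id _)
  rw [Finset.mem_sort, mem_blockInitiators] at ha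
  exact headI_sort (P.mem_part_self.2 ha.1) ha.2

lemma mem_standardForm {l : List ℕ} : l ∈ standardForm P ↔ ∃ t ∈ P.parts, t.sort = l := by
  simp only [standardForm, List.mem_map, Finset.mem_sort]
  constructor
  · rintro ⟨a, ha, rfl⟩
    exact ⟨_, P.part_mem.2 ((mem_blockInitiators P).1 ha).1, rfl⟩
  · rintro ⟨t, ht, rfl⟩
    have hne := P.nonempty_of_mem_parts ht
    have hmin := P.part_eq_of_mem ht (t.min'_mem hne)
    refine ⟨t.min' hne, ?_, by rw [hmin]⟩
    rw [mem_blockInitiators, hmin]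
    exact ⟨P.le ht (t.min'_mem hne), fun b hb => t.min'_le b hb⟩

lemma isStandard_standardForm : IsStandard (standardForm P) := by
  constructor
  · intro l hl
    obtain ⟨t, ht, rfl⟩ := (mem_standardForm P).1 hl
    refine ⟨?_, (Finset.sortedLT_sort t).pairwise⟩
    obtain ⟨a, ha⟩ := P.nonempty_of_mem_parts ht
    exact List.ne_nil_of_mem ((Finset.mem_sort _).2 ha)
  · rw [← List.pairwise_map (f := List.headI) (R := (· < ·)), map_headI_standardForm]
    exact (Finset.sortedLT_sort _).pairwise

lemma mem_flatten {x : ℕ} : x ∈ flatten P ↔ x ∈ Finset.Icc 1 n := by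
  rw [flatten, List.mem_flatten]
  constructor
  · rintro ⟨l, hl, hx⟩
    obtain ⟨t, ht, rfl⟩ := (mem_standardForm P).1 hl
    exact P.le ht ((Finset.mem_sort _).1 hx)
  · intro hx
    exact ⟨_, (mem_standardForm P).2 ⟨_, P.part_mem.2 hx, rfl⟩,
      (Finset.mem_sort _).2 (P.mem_part_self.2 hx)⟩

lemma nodup_flatten : (flatten P).Nodup := by
  rw [flatten, List.nodup_flatten]
  constructor
  · intro l hl
    obtain ⟨t, ht, rfl⟩ := (mem_standardForm P).1 hl
    exact Finset.sort_nodup _ _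
  · refine List.Pairwise.imp_of_mem ?_ (isStandard_standardForm P).2
    intro l l' hl hl' hlt x hx hx'
    obtain ⟨t, ht, rfl⟩ := (mem_standardForm P).1 hl
    obtain ⟨t', ht', rfl⟩ := (mem_standardForm P).1 hl'
    rw [Finset.mem_sort] at hx hx'
    rw [← P.part_eq_of_mem ht hx, ← P.part_eq_of_mem ht' hx'] at hlt
    exact lt_irrefl _ hlt

lemma flatten_perm : (flatten P).Perm (List.range' 1 n) := by
  rw [List.perm_ext_iff_of_nodup (nodup_flatten P) (List.nodup_range' (step := 1))]
  intro x
  rw [mem_flatten, Finset.mem_Icc, List.mem_range'_1]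
  omega

lemma mem_blockInitiators_iff_mem_heads {x : ℕ} :
    x ∈ blockInitiators P ↔ x ∈ (standardForm P).map List.headI := by
  rw [map_headI_standardForm, Finset.mem_sort]

lemma blockInitiators_subset_rightToLeftMinima :
    (blockInitiators P : Set ℕ) ⊆ rightToLeftMinima (flatten P) := fun x hx =>
  (isStandard_standardForm P).heads_subset_rightToLeftMinima x
    ((mem_blockInitiators_iff_mem_heads P).1 hx)

lemma descentTerminators_subset_blockInitiators :
    descentTerminators (flatten P) ⊆ (blockInitiators P : Set ℕ) := fun x hx =>
  (mem_blockInitiators_iff_mem_heads P).2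
    ((isStandard_standardForm P).descentTerminators_subset_heads (nodup_flatten P) x hx)

/-- A partition is determined by its flattening together with its block initiators. -/
lemma flatten_blockInitiators_injective :
    Function.Injective fun P : Finpartition (Finset.Icc 1 n) => (flatten P, blockInitiators P) := by
  intro P Q h
  obtain ⟨h1, h2⟩ := Prod.mk.inj h
  have hP := (isStandard_standardForm P).splitBy_flatten (nodup_flatten P)
    (fun x => mem_blockInitiators_iff_mem_heads P)
  have hQ := (isStandard_standardForm Q).splitBy_flatten (nodup_flatten Q)
    (fun x => mem_blockInitiators_iff_mem_heads Q)
  have hPQ : standardForm P = standardForm Q := by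
    rw [← hP, ← hQ, h2]
    congr 1
  have key (P : Finpartition (Finset.Icc 1 n)) (t : Finset ℕ) :
      t ∈ P.parts ↔ t.sort ∈ standardForm P := by
    rw [mem_standardForm]
    refine ⟨fun h => ⟨t, h, rfl⟩, ?_⟩
    rintro ⟨s, hs, he⟩
    rw [← t.sort_toFinset (· ≤ ·), ← he, Finset.sort_toFinset]
    exact hs
  ext t
  rw [key, key, hPQ]

end Partition

/-- Cutting a permutation before each letter of a set `S` of right-to-left minima containing all
descent terminators gives the standard form of a partition. -/
lemma isStandard_splitBy {w : List ℕ} (hw : w.Nodup) {S : Finset ℕ}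
    (hd : descentTerminators w ⊆ S) (hr : (S : Set ℕ) ⊆ rightToLeftMinima w) :
    IsStandard (w.splitBy fun _ b => decide (b ∉ S)) ∧
      ∀ x, x ∈ S ↔ x ∈ (w.splitBy fun _ b => decide (b ∉ S)).map List.headI := by
  set m := w.splitBy fun _ b => decide (b ∉ S) with hm
  have hf : m.flatten = w := List.flatten_splitBy _ _
  have hne : ∀ l ∈ m, l ≠ [] := fun l hl => List.ne_nil_of_mem_splitBy hl
  -- A letter that does not open its block lies outside `S`.
  have hchain : ∀ l ∈ m, ∀ a b l₁ l₂, l = l₁ ++ a :: b :: l₂ → b ∉ S := by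
    intro l hl a b l₁ l₂ he
    have := List.isChain_iff_forall_rel_of_append_cons_cons.1
      (List.isChain_of_mem_splitBy hl) he
    simpa using this
  have hhead : ∀ l ∈ m, l.headI ∈ S := by
    intro l hl
    obtain ⟨m₁, m₂, he⟩ := List.append_of_mem hl
    obtain ⟨a, t, rfl⟩ := List.exists_cons_of_ne_nil (hne l hl)
    rcases List.eq_nil_or_concat m₁ with rfl | ⟨m₁, l₀, rfl⟩
    · apply hd
      rw [mem_descentTerminators, ← hf, he]
      exact ⟨[], t ++ m₂.flatten, by simp, by simp⟩
    · have h := List.isChain_getLast_head_splitBy (fun _ b => decide (b ∉ S)) w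
      rw [← hm] at h
      obtain ⟨_, _, h⟩ := List.isChain_iff_forall_rel_of_append_cons_cons.1 h
        (show m = m₁ ++ l₀ :: (a :: t) :: m₂ by simpa using he)
      exact not_not.1 (of_decide_eq_false h)
  have htail : ∀ l ∈ m, ∀ x ∈ l, x ∈ S → l.headI = x := by
    intro l hl x hx hxS
    obtain ⟨r, s, he⟩ := List.append_of_mem hx
    rcases List.eq_nil_or_concat r with rfl | ⟨r, z, rfl⟩
    · simp [he]
    · exact absurd hxS (hchain l hl z x r s (by simpa using he))
  have hsub : ∀ x y, x ∈ rightToLeftMinima w → [x, y].Sublist w → x < y := by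
    intro x y hx hxy
    obtain ⟨u, v, rfl, h⟩ := mem_rightToLeftMinima.1 hx
    apply h
    have hxu : x ∉ u := fun hxu => List.disjoint_of_nodup_append hw hxu (by simp)
    have hxv := (List.nodup_cons.1 (List.nodup_append.1 hw).2.1).1
    obtain ⟨l₁, l₂, he, h₁, h₂⟩ := List.sublist_append_iff.1 hxy
    rcases l₁ with _ | ⟨a, l₁⟩
    · rw [List.nil_append] at he
      subst he
      exact List.singleton_sublist.1 (List.cons_sublist_cons.1 h₂)
    · obtain ⟨rfl, -⟩ := List.cons.inj he
      exact absurd (h₁.subset (by simp)) hxu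
  refine ⟨⟨fun l hl => ⟨hne l hl, ?_⟩, ?_⟩, fun x => ⟨fun hx => ?_, fun hx => ?_⟩⟩
  · refine List.IsChain.pairwise ?_
    rw [List.isChain_iff_forall_rel_of_append_cons_cons]
    intro a b l₁ l₂ he
    have hb := hchain l hl a b l₁ l₂ he
    obtain ⟨m₁, m₂, hm'⟩ := List.append_of_mem hl
    have hw' : w = (m₁.flatten ++ l₁ ++ [a]) ++ b :: (l₂ ++ m₂.flatten) := by
      rw [← hf, hm', he]
      simp
    by_contra hab
    refine hb (hd (mem_descentTerminators.2 ⟨_, _, hw', fun y hy => ?_⟩))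
    have hy : a = y := by simpa using hy
    subst hy
    have : a ≠ b := by
      rintro rfl
      rw [hw'] at hw
      exact List.disjoint_of_nodup_append hw (a := a) (by simp) (by simp)
    omega
  · refine List.pairwise_iff_forall_sublist.2 fun {l l'} hll => ?_
    have hl : l ∈ m := hll.subset (by simp)
    have hl' : l' ∈ m := hll.subset (by simp)
    refine hsub _ _ (hr (hhead l hl)) ?_
    have h1 : (l ++ l').Sublist w := by
      have := hll.flatten
      rw [hf] at this
      simpa using this
    exact (List.Sublist.append (l₁ := [l.headI]) (List.singleton_sublist.2 (headI_mem (hne l hl)))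
      (List.singleton_sublist.2 (headI_mem (hne l' hl')))).trans h1
  · have hxw := mem_of_mem_rightToLeftMinima (hr hx)
    rw [← hf] at hxw
    obtain ⟨l, hl, hxl⟩ := List.mem_flatten.1 hxw
    exact List.mem_map.2 ⟨l, hl, htail l hl x hxl hx⟩
  · obtain ⟨l, hl, rfl⟩ := List.mem_map.1 hx
    exact hhead l hl

lemma IsStandard.exists_standardForm_eq {n : ℕ} {m : List (List ℕ)} (hm : IsStandard m)
    (hp : m.flatten.Perm (List.range' 1 n)) :
    ∃ P : Finpartition (Finset.Icc 1 n), standardForm P = m := by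
  have hn : m.flatten.Nodup := hp.nodup_iff.2 (List.nodup_range' (step := 1))
  have hmem (x : ℕ) : x ∈ Finset.Icc 1 n ↔ ∃ l ∈ m, x ∈ l := by
    rw [← List.mem_flatten, hp.mem_iff, Finset.mem_Icc, List.mem_range'_1]
    omega
  let P : Finpartition (Finset.Icc 1 n) :=
    Finpartition.ofExistsUnique (m.map List.toFinset).toFinset
      (by
        intro p hp x hx
        obtain ⟨l, hl, rfl⟩ := List.mem_map.1 (List.mem_toFinset.1 hp)
        exact (hmem x).2 ⟨l, hl, List.mem_toFinset.1 hx⟩)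
      (by
        intro x hx
        obtain ⟨l, hl, hxl⟩ := (hmem x).1 hx
        refine ⟨l.toFinset, ⟨List.mem_toFinset.2 (List.mem_map_of_mem hl),
          List.mem_toFinset.2 hxl⟩, ?_⟩
        rintro t ⟨ht, hxt⟩
        obtain ⟨l', hl', rfl⟩ := List.mem_map.1 (List.mem_toFinset.1 ht)
        rw [eq_of_mem_of_nodup_flatten hn hl' hl (List.mem_toFinset.1 hxt) hxl])
      (by
        intro h
        obtain ⟨l, hl, he⟩ := List.mem_map.1 (List.mem_toFinset.1 h)
        exact (hm.1 l hl).1 (by simpa using he))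
  have hpart {l : List ℕ} (hl : l ∈ m) {x : ℕ} (hx : x ∈ l) : P.part x = l.toFinset :=
    P.part_eq_of_mem (List.mem_toFinset.2 (List.mem_map_of_mem hl)) (List.mem_toFinset.2 hx)
  have hI : blockInitiators P = (m.map List.headI).toFinset := by
    ext x
    rw [mem_blockInitiators, List.mem_toFinset, List.mem_map, hmem]
    constructor
    · rintro ⟨⟨l, hl, hx⟩, h⟩
      rw [hpart hl hx] at h
      refine ⟨l, hl, (headI_le_of_mem (hm.1 l hl).2 hx).antisymm (h _ ?_)⟩
      exact List.mem_toFinset.2 (headI_mem (hm.1 l hl).1)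
    · rintro ⟨l, hl, rfl⟩
      have hx := headI_mem (hm.1 l hl).1
      refine ⟨⟨l, hl, hx⟩, fun b hb => ?_⟩
      rw [hpart hl hx, List.mem_toFinset] at hb
      exact headI_le_of_mem (hm.1 l hl).2 hb
  have hh : (m.map List.headI).Pairwise (· < ·) := List.pairwise_map.2 hm.2
  refine ⟨P, ?_⟩
  rw [standardForm, hI, (List.toFinset_sort (· ≤ ·) (hh.imp ne_of_lt)).2 (hh.imp le_of_lt),
    List.map_map]
  refine (List.map_congr_left fun l hl => ?_).trans (List.map_id _)
  have hl' := (hm.1 l hl).2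
  rw [Function.comp_apply, hpart hl (headI_mem (hm.1 l hl).1),
    (List.toFinset_sort (· ≤ ·) (hl'.imp ne_of_lt)).2 (hl'.imp le_of_lt), id]

/-- Every permutation of `[n]` with a set of marked right-to-left minima that includes the descent
terminators comes from a partition. -/
lemma exists_flatten_eq {n : ℕ} {w : List ℕ} (hw : w.Perm (List.range' 1 n)) {S : Finset ℕ}
    (hd : descentTerminators w ⊆ S) (hr : (S : Set ℕ) ⊆ rightToLeftMinima w) :
    ∃ P : Finpartition (Finset.Icc 1 n), flatten P = w ∧ blockInitiators P = S := by
  obtain ⟨hs, hS⟩ := isStandard_splitBy (hw.nodup_iff.2 (List.nodup_range' (step := 1))) hd hr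
  have hf : (w.splitBy fun _ b => decide (b ∉ S)).flatten = w := List.flatten_splitBy _ _
  obtain ⟨P, hP⟩ := hs.exists_standardForm_eq (n := n) (by rwa [hf])
  refine ⟨P, by rw [flatten, hP, hf], ?_⟩
  ext x
  rw [hS, mem_blockInitiators_iff_mem_heads, hP]

end FlattenPartition

namespace FlattenPartition
open Finset

/-! ### Motzkin polynomials -/

/-- The generating polynomial of Motzkin paths of length `m` by their number `k` of level steps:
choose the positions of the level steps, and a Dyck path of length `m - k` for the other steps. -/
noncomputable def motzkin (m : ℕ) : Polynomial ℕ :=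
  ∑ k ∈ range (m + 1), Polynomial.monomial k (m.choose k * catalanHalf (m - k))

lemma coeff_motzkin (m k : ℕ) : (motzkin m).coeff k = m.choose k * catalanHalf (m - k) := by
  simp only [motzkin, Polynomial.finsetSum_coeff, Polynomial.coeff_monomial]
  rw [sum_ite_eq' (range (m + 1)) k]
  split_ifs with h
  · rfl
  · rw [Nat.choose_eq_zero_of_lt (by simpa using h), zero_mul]

/-- The coefficients of `(1 - X)⁻¹ ^ (a + 1) * (1 - X)⁻¹ ^ (b + 1) = (1 - X)⁻¹ ^ (a + b + 2)`. -/
lemma sum_choose_mul_choose (a b k : ℕ) :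
    ∑ p ∈ antidiagonal k, (a + p.1).choose a * (b + p.2).choose b =
      (a + b + 1 + k).choose (a + b + 1) := by
  have h := congrArg (PowerSeries.coeff k)
    (pow_add (PowerSeries.mk 1 : PowerSeries ℤ) (a + 1) (b + 1))
  rw [show a + 1 + (b + 1) = a + b + 1 + 1 by ring, PowerSeries.mk_one_pow_eq_mk_choose_add,
    PowerSeries.mk_one_pow_eq_mk_choose_add, PowerSeries.mk_one_pow_eq_mk_choose_add,
    PowerSeries.coeff_mul] at h
  simp only [PowerSeries.coeff_mk] at h
  exact_mod_cast h.symm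

/-- The Catalan recursion; for odd `d` both sides vanish. -/
lemma sum_catalanHalf_mul_catalanHalf (d : ℕ) :
    ∑ p ∈ antidiagonal d, catalanHalf p.1 * catalanHalf p.2 = catalanHalf (d + 2) := by
  by_cases hd : Even d
  · obtain ⟨j, rfl⟩ := hd
    have h1 : catalanHalf (j + j + 2) = catalan (j + 1) := by
      rw [catalanHalf, if_pos (by exact ⟨j + 1, by ring⟩)]
      congr 1
      omega
    rw [h1, catalan_succ']
    symm
    refine Finset.sum_of_injOn (fun p => (p.1 + p.1, p.2 + p.2)) ?_ ?_ ?_ ?_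
    · rintro ⟨a, b⟩ - ⟨c, d⟩ - h
      simp only [Prod.mk.injEq] at h ⊢
      omega
    · rintro ⟨a, b⟩ h
      simp only [HasAntidiagonal.mem_antidiagonal, mem_coe] at h ⊢
      omega
    · rintro ⟨a, b⟩ h hn
      rw [HasAntidiagonal.mem_antidiagonal] at h
      have ha : ¬ Even a := by
        rintro ⟨c, rfl⟩
        exact hn ⟨(c, j - c), by simp; omega, by simp; omega⟩
      simp [catalanHalf, ha]
    · rintro ⟨a, b⟩ -
      have h (a : ℕ) : (a + a) / 2 = a := by omega
      simp [catalanHalf, h]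
  · have h2 : ¬ Even (d + 2) := by simpa [Nat.even_add] using hd
    rw [catalanHalf, if_neg h2]
    refine Finset.sum_eq_zero fun p hp => ?_
    rw [HasAntidiagonal.mem_antidiagonal] at hp
    have : ¬ Even p.1 ∨ ¬ Even p.2 := by
      by_contra! h
      exact hd (hp ▸ h.1.add h.2)
    rcases this with h | h <;> simp [catalanHalf, h]

lemma coeff_sum_motzkin_mul_motzkin (m k : ℕ) :
    (∑ p ∈ antidiagonal m, motzkin p.1 * motzkin p.2).coeff k =
      (m + 1).choose k * catalanHalf (m + 2 - k) := by
  simp only [Polynomial.finsetSum_coeff, Polynomial.coeff_mul, coeff_motzkin]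
  rw [Finset.sum_comm]
  rcases lt_or_ge m k with hk | hk
  · have h0 : (m + 1).choose k * catalanHalf (m + 2 - k) = 0 := by
      rcases eq_or_lt_of_le (Nat.succ_le_of_lt hk) with rfl | h
      · simp [catalanHalf, show m + 2 - m.succ = 1 by omega]
      · rw [Nat.choose_eq_zero_of_lt h, zero_mul]
    rw [h0]
    refine Finset.sum_eq_zero fun q hq => Finset.sum_eq_zero fun p hp => ?_
    rw [HasAntidiagonal.mem_antidiagonal] at hp hq
    have : p.1 < q.1 ∨ p.2 < q.2 := by omega
    rcases this with h | h <;> simp [Nat.choose_eq_zero_of_lt h]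
  · obtain ⟨d, rfl⟩ := Nat.exists_eq_add_of_le hk
    -- Terms with `p < q` in some coordinate vanish; the others are `p = q + c`.
    have h (q : ℕ × ℕ) (hq : q ∈ antidiagonal k) :
        ∑ p ∈ antidiagonal (k + d), p.1.choose q.1 * catalanHalf (p.1 - q.1) *
          (p.2.choose q.2 * catalanHalf (p.2 - q.2)) =
        ∑ c ∈ antidiagonal d, catalanHalf c.1 * catalanHalf c.2 *
          ((c.1 + q.1).choose c.1 * (c.2 + q.2).choose c.2) := by
      rw [HasAntidiagonal.mem_antidiagonal] at hq
      symm
      refine Finset.sum_of_injOn (fun c => (c.1 + q.1, c.2 + q.2)) ?_ ?_ ?_ ?_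
      · rintro ⟨a, b⟩ - ⟨c, d⟩ - h
        simp only [Prod.mk.injEq] at h ⊢
        omega
      · rintro ⟨a, b⟩ h
        simp only [mem_coe, HasAntidiagonal.mem_antidiagonal] at h ⊢
        omega
      · rintro ⟨a, b⟩ h hn
        rw [HasAntidiagonal.mem_antidiagonal] at h
        dsimp only at h
        have : a < q.1 ∨ b < q.2 := by
          by_contra! hab
          refine hn ⟨(a - q.1, b - q.2), ?_, ?_⟩
          · simp only [mem_coe, HasAntidiagonal.mem_antidiagonal]
            omega
          · simp only [Prod.mk.injEq]
            omega
        rcases this with h | h <;> simp [Nat.choose_eq_zero_of_lt h]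
      · rintro ⟨a, b⟩ -
        simp only [Nat.add_sub_cancel]
        rw [Nat.choose_symm_add (a := a), Nat.choose_symm_add (a := b)]
        ring
    rw [Finset.sum_congr rfl h, Finset.sum_comm]
    have h' (c : ℕ × ℕ) (hc : c ∈ antidiagonal d) :
        ∑ q ∈ antidiagonal k, catalanHalf c.1 * catalanHalf c.2 *
          ((c.1 + q.1).choose c.1 * (c.2 + q.2).choose c.2) =
        catalanHalf c.1 * catalanHalf c.2 * (k + d + 1).choose k := by
      rw [HasAntidiagonal.mem_antidiagonal] at hc
      rw [← Finset.mul_sum, sum_choose_mul_choose, hc, Nat.choose_symm_add]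
      congr 2
      omega
    rw [Finset.sum_congr rfl h', ← Finset.sum_mul, sum_catalanHalf_mul_catalanHalf, mul_comm]
    congr 2
    omega

lemma motzkin_zero : motzkin 0 = 1 := by
  simp [motzkin, catalanHalf]

lemma motzkin_one : motzkin 1 = Polynomial.X := by
  simp [motzkin, Finset.sum_range_succ, catalanHalf, Polynomial.X]

/-- A Motzkin path starts with a level step, or with an up step that is matched by a later down
step. Algebraically, the coefficients are those of Pascal's rule. -/
lemma motzkin_add_two (m : ℕ) :
    motzkin (m + 2) =
      Polynomial.X * motzkin (m + 1) + ∑ p ∈ antidiagonal m, motzkin p.1 * motzkin p.2 := by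
  ext k
  rw [Polynomial.coeff_add, coeff_sum_motzkin_mul_motzkin, coeff_motzkin]
  rcases k with _ | k
  · simp
  · rw [Polynomial.coeff_X_mul, coeff_motzkin, Nat.choose_succ_succ, add_mul]
    congr 3
    omega

/-- Touchard's identity. -/
lemma eval_motzkin (m : ℕ) : (motzkin m).eval 2 = catalan (m + 1) := by
  induction m using Nat.strong_induction_on with
  | _ m ih =>
    rcases m with _ | _ | m
    · simp [motzkin_zero]
    · simp [motzkin_one, catalan_two]
    · rw [motzkin_add_two, catalan_succ', Nat.antidiagonal_succ_succ', sum_cons, sum_cons, sum_map]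
      simp only [Polynomial.eval_add, Polynomial.eval_mul, Polynomial.eval_X,
        Polynomial.eval_finsetSum, ih (m + 1) (by omega)]
      have h : ∑ p ∈ antidiagonal m, (motzkin p.1).eval 2 * (motzkin p.2).eval 2 =
          ∑ p ∈ antidiagonal m, catalan (p.1 + 1) * catalan (p.2 + 1) := by
        refine Finset.sum_congr rfl fun p hp => ?_
        rw [HasAntidiagonal.mem_antidiagonal] at hp
        rw [ih p.1 (by omega), ih p.2 (by omega)]
      simp [h]
      ring

end FlattenPartition

namespace FlattenPartition
open Finset

/-! ### Counting the flattenings -/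

open Classical in
/-- The 231-avoiding permutations of `[n]` all of whose descent terminators are right-to-left
minima. These are the 231-avoiding flattenings of partitions. -/
noncomputable def flatWords (n : ℕ) : Finset (List ℕ) :=
  (List.range' 1 n).permutations.toFinset.filter fun w =>
    Avoids231 w ∧ descentTerminators w ⊆ rightToLeftMinima w

lemma mem_flatWords {n : ℕ} {w : List ℕ} :
    w ∈ flatWords n ↔ w.Perm (List.range' 1 n) ∧ Avoids231 w ∧
      descentTerminators w ⊆ rightToLeftMinima w := by
  simp [flatWords]

/-- The number of right-to-left minima of a word that are not descent terminators. -/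
noncomputable def freeMinima (w : List ℕ) : ℕ :=
  (rightToLeftMinima w \ descentTerminators w).ncard

/-- The distribution of `freeMinima` on the 231-avoiding flattenings of partitions of `[n]`. -/
noncomputable def flatPoly (n : ℕ) : Polynomial ℕ :=
  ∑ w ∈ flatWords n, Polynomial.X ^ freeMinima w

lemma finite_rightToLeftMinima (w : List ℕ) : (rightToLeftMinima w).Finite :=
  w.toFinset.finite_toSet.subset fun x hx => by
    simpa using mem_of_mem_rightToLeftMinima hx

lemma coeff_flatPoly (n k : ℕ) :
    (flatPoly n).coeff k = #{w ∈ flatWords n | freeMinima w = k} := by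
  simp only [flatPoly, Polynomial.finsetSum_coeff, Polynomial.coeff_X_pow, Finset.card_filter]
  simp only [eq_comm]

lemma descentTerminators_nil : descentTerminators [] = ∅ := by
  ext x
  simp [mem_descentTerminators]

lemma rightToLeftMinima_nil : rightToLeftMinima [] = ∅ := by
  ext x
  simp [mem_rightToLeftMinima]

lemma flatWords_zero : flatWords 0 = {[]} := by
  ext w
  simp only [mem_flatWords, List.range'_zero, List.perm_nil, mem_singleton]
  refine ⟨fun h => h.1, ?_⟩
  rintro rfl
  refine ⟨rfl, fun a b c h => by simp at h, by simp [descentTerminators_nil]⟩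

lemma flatPoly_zero : flatPoly 0 = 1 := by
  simp [flatPoly, flatWords_zero, freeMinima, rightToLeftMinima_nil]

lemma descentTerminators_singleton (a : ℕ) : descentTerminators [a] = {a} := by
  ext x
  rw [mem_descentTerminators, Set.mem_singleton_iff]
  constructor
  · rintro ⟨u, v, he, -⟩
    have : x ∈ [a] := by simp [he]
    simpa using this
  · rintro rfl
    exact ⟨[], [], rfl, by simp⟩

lemma rightToLeftMinima_singleton (a : ℕ) : rightToLeftMinima [a] = {a} := by
  ext x
  rw [mem_rightToLeftMinima_cons, rightToLeftMinima_nil]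
  simp

lemma flatWords_one : flatWords 1 = {[1]} := by
  ext w
  simp only [mem_flatWords, List.range'_one, List.perm_singleton, mem_singleton]
  refine ⟨fun h => h.1, ?_⟩
  rintro rfl
  refine ⟨rfl, fun a b c h => by simpa using h.length_le, ?_⟩
  rw [descentTerminators_singleton, rightToLeftMinima_singleton]

lemma flatPoly_one : flatPoly 1 = 1 := by
  simp [flatPoly, flatWords_one, freeMinima, rightToLeftMinima_singleton,
    descentTerminators_singleton]

section Glue

variable {u v : List ℕ} {m : ℕ}

lemma rightToLeftMinima_append_cons (hu : ∀ x ∈ u, x < m) (hv : ∀ x ∈ v, x < m)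
    (huv : ∀ x ∈ u, ∀ y ∈ v, x < y) :
    rightToLeftMinima (u ++ m :: v) =
      rightToLeftMinima u ∪ (rightToLeftMinima v ∪ {x | x = m ∧ v = []}) := by
  ext x
  rw [mem_rightToLeftMinima_append, mem_rightToLeftMinima_cons]
  constructor
  · rintro (⟨h, -⟩ | ⟨rfl, h⟩ | h)
    · exact Or.inl h
    · refine Or.inr (Or.inr ⟨rfl, List.eq_nil_iff_forall_not_mem.2 fun y hy => ?_⟩)
      have := h y hy
      have := hv y hy
      omega
    · exact Or.inr (Or.inl h)
  · rintro (h | h | ⟨rfl, rfl⟩)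
    · have hx := mem_of_mem_rightToLeftMinima h
      refine Or.inl ⟨h, fun y hy => ?_⟩
      rcases List.mem_cons.1 hy with rfl | hy
      exacts [hu x hx, huv x hx y hy]
    · exact Or.inr (Or.inr h)
    · exact Or.inr (Or.inl ⟨rfl, by simp⟩)

lemma descentTerminators_append_cons (hu : ∀ x ∈ u, x < m) (hv : ∀ x ∈ v, x < m) (hne : u ≠ []) :
    descentTerminators (u ++ m :: v) = descentTerminators u ∪ descentTerminators v :=
  Set.ext fun _ => mem_descentTerminators_append_cons hu hv hne

lemma descentTerminators_subset_append_cons (hu : ∀ x ∈ u, x < m) (hv : ∀ x ∈ v, x < m)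
    (huv : ∀ x ∈ u, ∀ y ∈ v, x < y) (hne : u ≠ []) :
    descentTerminators (u ++ m :: v) ⊆ rightToLeftMinima (u ++ m :: v) ↔
      descentTerminators u ⊆ rightToLeftMinima u ∧
        descentTerminators v ⊆ rightToLeftMinima v := by
  rw [rightToLeftMinima_append_cons hu hv huv, descentTerminators_append_cons hu hv hne,
    Set.union_subset_iff]
  refine and_congr ⟨fun h x hx => ?_, fun h x hx => Or.inl (h hx)⟩
    ⟨fun h x hx => ?_, fun h x hx => Or.inr (Or.inl (h hx))⟩
  · have hxu := mem_of_mem_descentTerminators hx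
    rcases h hx with h | h | ⟨rfl, -⟩
    · exact h
    · exact absurd (huv x hxu x (mem_of_mem_rightToLeftMinima h)) (lt_irrefl x)
    · exact absurd (hu x hxu) (lt_irrefl x)
  · have hxv := mem_of_mem_descentTerminators hx
    rcases h hx with h | h | ⟨rfl, -⟩
    · exact absurd (huv x (mem_of_mem_rightToLeftMinima h) x hxv) (lt_irrefl x)
    · exact h
    · exact absurd (hv x hxv) (lt_irrefl x)

lemma freeMinima_append_singleton (hu : ∀ x ∈ u, x < m) (hne : u ≠ []) :
    freeMinima (u ++ [m]) = freeMinima u + 1 := by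
  have h : rightToLeftMinima (u ++ [m]) \ descentTerminators (u ++ [m]) =
      insert m (rightToLeftMinima u \ descentTerminators u) := by
    rw [rightToLeftMinima_append_cons hu (by simp) (by simp),
      descentTerminators_append_cons hu (by simp) hne]
    ext x
    have hm : m ∉ descentTerminators u := fun h =>
      lt_irrefl m (hu m (mem_of_mem_descentTerminators h))
    by_cases hx : x = m
    · subst hx
      simp [hm, descentTerminators_nil]
    · simp [hx, rightToLeftMinima_nil, descentTerminators_nil]
  rw [freeMinima, h, Set.ncard_insert_of_notMem _ ((finite_rightToLeftMinima u).sdiff), freeMinima]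
  exact fun h => lt_irrefl m (hu m (mem_of_mem_rightToLeftMinima h.1))

lemma freeMinima_append_cons (hu : ∀ x ∈ u, x < m) (hv : ∀ x ∈ v, x < m)
    (huv : ∀ x ∈ u, ∀ y ∈ v, x < y) (hne : u ≠ []) (hne' : v ≠ []) :
    freeMinima (u ++ m :: v) = freeMinima u + freeMinima v := by
  have h : rightToLeftMinima (u ++ m :: v) \ descentTerminators (u ++ m :: v) =
      (rightToLeftMinima u \ descentTerminators u) ∪
        (rightToLeftMinima v \ descentTerminators v) := by
    rw [rightToLeftMinima_append_cons hu hv huv, descentTerminators_append_cons hu hv hne]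
    ext x
    simp only [hne', and_false, Set.mem_sdiff, Set.mem_union, Set.mem_ofPred_eq, or_false]
    have h1 : x ∈ rightToLeftMinima u → x ∉ descentTerminators v := fun h h' => lt_irrefl x
      (huv x (mem_of_mem_rightToLeftMinima h) x (mem_of_mem_descentTerminators h'))
    have h2 : x ∈ rightToLeftMinima v → x ∉ descentTerminators u := fun h h' => lt_irrefl x
      (huv x (mem_of_mem_descentTerminators h') x (mem_of_mem_rightToLeftMinima h))
    tauto
  rw [freeMinima, h, Set.ncard_union_eq _ (finite_rightToLeftMinima u).sdiff
    (finite_rightToLeftMinima v).sdiff, freeMinima, freeMinima]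
  rw [Set.disjoint_left]
  exact fun x h h' => lt_irrefl x
    (huv x (mem_of_mem_rightToLeftMinima h.1) x (mem_of_mem_rightToLeftMinima h'.1))

end Glue

lemma freeMinima_map {f : ℕ → ℕ} (hf : StrictMono f) (w : List ℕ) :
    freeMinima (w.map f) = freeMinima w := by
  rw [freeMinima, rightToLeftMinima_map hf, descentTerminators_map hf,
    ← Set.image_sdiff hf.injective, Set.ncard_image_of_injective _ hf.injective, freeMinima]

/-- Put the letter `a + b + 1` after a word `u` on `[a]` and follow it by a word `v` on `[b]`
shifted by `a`. -/
def glue (a b : ℕ) (u v : List ℕ) : List ℕ := u ++ (a + b + 1) :: v.map (a + ·)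

lemma range'_perm_glue (a b : ℕ) :
    (List.range' 1 (a + b + 1)).Perm (List.range' 1 a ++ (a + b + 1) ::
      (List.range' 1 b).map (a + ·)) := by
  rw [List.map_add_range', List.range'_1_concat]
  refine List.Perm.trans ?_ List.perm_middle.symm
  rw [← List.range'_append_1 (s := 1) (m := a) (n := b)]
  refine (List.perm_append_singleton _ _).trans ?_
  rw [show 1 + (a + b) = a + b + 1 by ring, show 1 + a = a + 1 by ring]

section GlueWords

variable {a b : ℕ} {u v : List ℕ}

lemma mem_perm_range' {w : List ℕ} (hw : w.Perm (List.range' 1 a)) {x : ℕ} :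
    x ∈ w ↔ 1 ≤ x ∧ x ≤ a := by
  rw [hw.mem_iff, List.mem_range'_1]
  omega

lemma glue_bounds (hu : u.Perm (List.range' 1 a)) (hv : v.Perm (List.range' 1 b)) :
    (∀ x ∈ u, x < a + b + 1) ∧ (∀ x ∈ v.map (a + ·), x < a + b + 1) ∧
      ∀ x ∈ u, ∀ y ∈ v.map (a + ·), x < y := by
  refine ⟨fun x hx => ?_, fun x hx => ?_, fun x hx y hy => ?_⟩
  · rw [mem_perm_range' hu] at hx
    omega
  · obtain ⟨z, hz, rfl⟩ := List.mem_map.1 hx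
    rw [mem_perm_range' hv] at hz
    omega
  · obtain ⟨z, hz, rfl⟩ := List.mem_map.1 hy
    rw [mem_perm_range' hu] at hx
    rw [mem_perm_range' hv] at hz
    omega

lemma strictMono_add (a : ℕ) : StrictMono (a + ·) := fun _ _ h => Nat.add_lt_add_left h a

lemma glue_mem_flatWords (ha : a ≠ 0) (hu : u.Perm (List.range' 1 a))
    (hv : v.Perm (List.range' 1 b)) :
    glue a b u v ∈ flatWords (a + b + 1) ↔ u ∈ flatWords a ∧ v ∈ flatWords b := by
  obtain ⟨h1, h2, h3⟩ := glue_bounds hu hv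
  have hne : u ≠ [] := by
    rintro rfl
    have := hu.length_eq
    simp at this
    omega
  have hp : (glue a b u v).Perm (List.range' 1 (a + b + 1)) :=
    (hu.append ((hv.map _).cons _)).trans (range'_perm_glue a b).symm
  rw [mem_flatWords, mem_flatWords, mem_flatWords]
  rw [glue] at hp ⊢
  rw [avoids231_append_cons h1 h2, descentTerminators_subset_append_cons h1 h2 h3 hne,
    avoids231_map (strictMono_add a), descentTerminators_map (strictMono_add a),
    rightToLeftMinima_map (strictMono_add a),
    Set.image_subset_image_iff (strictMono_add a).injective]
  have h3' : ∀ x ∈ u, ∀ y ∈ v.map (a + ·), x ≤ y := fun x hx y hy => (h3 x hx y hy).le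
  tauto

lemma freeMinima_glue (ha : a ≠ 0) (hu : u.Perm (List.range' 1 a))
    (hv : v.Perm (List.range' 1 b)) :
    freeMinima (glue a b u v) = freeMinima u + if b = 0 then 1 else freeMinima v := by
  obtain ⟨h1, h2, h3⟩ := glue_bounds hu hv
  have hne : u ≠ [] := by
    rintro rfl
    have := hu.length_eq
    simp at this
    omega
  split_ifs with hb
  · subst hb
    obtain rfl : v = [] := by simpa using hv
    exact freeMinima_append_singleton h1 hne
  · have hne' : v.map (a + ·) ≠ [] := by
      intro h
      have := hv.length_eq
      simp at h
      simp [h] at this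
      omega
    rw [glue, freeMinima_append_cons h1 h2 h3 hne hne', freeMinima_map (strictMono_add a)]

end GlueWords

/-- A permutation of `[n]` in which the letters before `n` are smaller than those after `n` is
glued from two permutations. -/
lemma exists_eq_glue {n : ℕ} {u v : List ℕ}
    (hp : (u ++ (n + 1) :: v).Perm (List.range' 1 (n + 1))) (huv : ∀ x ∈ u, ∀ y ∈ v, x ≤ y) :
    ∃ a b v', a + b = n ∧ u.Perm (List.range' 1 a) ∧ v'.Perm (List.range' 1 b) ∧
      u ++ (n + 1) :: v = glue a b u v' := by
  have hp' : (u ++ v).Perm (List.range' 1 n) := by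
    have h := List.perm_middle.symm.trans hp
    rw [List.range'_1_concat, show 1 + n = n + 1 by ring] at h
    exact (List.perm_cons _).1 (h.trans (List.perm_append_singleton _ _))
  have hlen : u.length + v.length = n := by simpa using hp'.length_eq
  -- Both sides of `n + 1`, sorted, concatenate to `1, …, n`.
  set su := u.mergeSort (· ≤ ·) with hsu
  set sv := v.mergeSort (· ≤ ·) with hsv
  have hu : su.Perm u := List.mergeSort_perm _ _
  have hv : sv.Perm v := List.mergeSort_perm _ _
  have hs : su ++ sv = List.range' 1 u.length ++ List.range' (1 + u.length) v.length := by
    rw [List.range'_append_1, hlen]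
    refine ((hu.append hv).trans hp').eq_of_pairwise (le := (· ≤ ·))
      (fun a b _ _ h h' => le_antisymm h h') ?_ ?_
    · refine List.pairwise_append.2 ⟨List.pairwise_mergeSort' _ _, List.pairwise_mergeSort' _ _, ?_⟩
      exact fun x hx y hy => huv x (hu.mem_iff.1 hx) y (hv.mem_iff.1 hy)
    · exact List.pairwise_le_range'
  obtain ⟨hs1, hs2⟩ := List.append_inj hs (by simp [hu.length_eq])
  have hu' : u.Perm (List.range' 1 u.length) := hs1 ▸ hu.symm
  have hv' : v.Perm ((List.range' 1 v.length).map (u.length + ·)) := by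
    rw [List.map_add_range', add_comm u.length 1]
    exact hs2 ▸ hv.symm
  refine ⟨u.length, v.length, v.map (· - u.length), hlen, hu', ?_, ?_⟩
  · have := hv'.map (· - u.length)
    rw [List.map_map] at this
    refine this.trans (List.Perm.of_eq ?_)
    refine (List.map_congr_left fun x _ => ?_).trans (List.map_id _)
    simp
  · rw [glue, hlen, List.map_map]
    congr 2
    symm
    refine (List.map_congr_left fun x hx => ?_).trans (List.map_id _)
    obtain ⟨y, -, rfl⟩ := List.mem_map.1 (hv'.mem_iff.1 hx)
    simp

lemma glue_injective {a b a' b' : ℕ} {u v u' v' : List ℕ} (hab : a + b = a' + b')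
    (hu : u.Perm (List.range' 1 a)) (hv : v.Perm (List.range' 1 b))
    (hu' : u'.Perm (List.range' 1 a')) (h : glue a b u v = glue a' b' u' v') :
    a = a' ∧ b = b' ∧ u = u' ∧ v = v' := by
  obtain ⟨h1, h2, -⟩ := glue_bounds hu hv
  rw [glue, glue, ← hab] at h
  obtain ⟨rfl, -, h⟩ := (List.append_cons_inj_of_notMem
    (fun hx => lt_irrefl _ (h1 _ hx)) (fun hx => lt_irrefl _ (h2 _ hx))).1 h
  obtain rfl : a = a' := by simpa using hu.length_eq.symm.trans hu'.length_eq
  exact ⟨rfl, by omega, rfl, List.map_injective_iff.2 (strictMono_add a).injective h⟩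

end FlattenPartition

namespace FlattenPartition
open Finset

lemma sum_X_pow_freeMinima_glue {a b : ℕ} (ha : a ≠ 0) :
    ∑ x ∈ flatWords a ×ˢ flatWords b,
        (Polynomial.X : Polynomial ℕ) ^ freeMinima (glue a b x.1 x.2) =
      flatPoly a * if b = 0 then Polynomial.X else flatPoly b := by
  have h : ∀ x ∈ flatWords a ×ˢ flatWords b,
      (Polynomial.X : Polynomial ℕ) ^ freeMinima (glue a b x.1 x.2) =
        Polynomial.X ^ freeMinima x.1 *
          Polynomial.X ^ (if b = 0 then 1 else freeMinima x.2) := by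
    rintro ⟨u, v⟩ hx
    obtain ⟨hu, hv⟩ := mem_product.1 hx
    rw [freeMinima_glue ha (mem_flatWords.1 hu).1 (mem_flatWords.1 hv).1, pow_add]
  rw [sum_congr rfl h, sum_product]
  dsimp only
  rw [← sum_mul_sum, flatPoly]
  split_ifs with hb
  · subst hb
    simp [flatWords_zero]
  · rfl

/-- The recursion obtained by splitting a word at its greatest letter, which contributes to
`freeMinima` only if it comes last. -/
lemma flatPoly_add_two (n : ℕ) :
    flatPoly (n + 2) = ∑ p ∈ antidiagonal n,
      flatPoly (p.1 + 1) * if p.2 = 0 then Polynomial.X else flatPoly p.2 := by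
  rw [← sum_congr rfl fun p (_ : p ∈ antidiagonal n) =>
    sum_X_pow_freeMinima_glue (b := p.2) (Nat.succ_ne_zero p.1), sum_sigma', flatPoly]
  symm
  refine sum_nbij (fun x => glue (x.1.1 + 1) x.1.2 x.2.1 x.2.2) ?_ ?_ ?_ fun _ _ => rfl
  · rintro ⟨⟨i, j⟩, u, v⟩ hx
    simp only [mem_sigma, HasAntidiagonal.mem_antidiagonal, mem_product] at hx
    obtain ⟨hij, hu, hv⟩ := hx
    have := (glue_mem_flatWords (Nat.succ_ne_zero i) (mem_flatWords.1 hu).1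
      (mem_flatWords.1 hv).1).2 ⟨hu, hv⟩
    rwa [show i.succ + j + 1 = n + 2 by omega] at this
  · rintro ⟨⟨i, j⟩, u, v⟩ hx ⟨⟨i', j'⟩, u', v'⟩ hx' h
    simp only [mem_coe, mem_sigma, HasAntidiagonal.mem_antidiagonal, mem_product] at hx hx'
    obtain ⟨hij, hu, hv⟩ := hx
    obtain ⟨hij', hu', hv'⟩ := hx'
    obtain ⟨h1, rfl, rfl, rfl⟩ := glue_injective
      (show i + 1 + j = i' + 1 + j' by omega) (mem_flatWords.1 hu).1
      (mem_flatWords.1 hv).1 (mem_flatWords.1 hu').1 h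
    obtain rfl : i = i' := by omega
    rfl
  · intro w hw
    obtain ⟨hp, ha, hd⟩ := mem_flatWords.1 (mem_coe.1 hw)
    obtain ⟨u, v, rfl⟩ := List.append_of_mem ((mem_perm_range' hp).2 ⟨by omega, le_rfl⟩)
    have hn : (u ++ (n + 2) :: v).Nodup := hp.nodup_iff.2 (List.nodup_range' (step := 1))
    have hle : ∀ x ∈ u ++ (n + 2) :: v, x ≤ n + 2 := fun x hx => ((mem_perm_range' hp).1 hx).2
    have hu : ∀ x ∈ u, x < n + 2 := fun x hx => by
      refine lt_of_le_of_ne (hle x (by simp [hx])) ?_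
      rintro rfl
      exact List.disjoint_of_nodup_append hn hx (by simp)
    have hv : ∀ x ∈ v, x < n + 2 := fun x hx => by
      refine lt_of_le_of_ne (hle x (by simp [hx])) ?_
      rintro rfl
      exact (List.nodup_cons.1 (List.nodup_append.1 hn).2.1).1 hx
    obtain ⟨a, b, v', hab, hu', hv', he⟩ :=
      exists_eq_glue hp ((avoids231_append_cons hu hv).1 ha).2.2
    -- The greatest letter cannot come first: it would be a right-to-left minimum.
    have ha0 : a ≠ 0 := by
      rintro rfl
      obtain rfl : u = [] := by simpa using hu'
      have h := hd (mem_descentTerminators.2 ⟨[], v, rfl, by simp⟩)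
      rw [List.nil_append, mem_rightToLeftMinima_cons] at h
      obtain ⟨y, hy⟩ : ∃ y, y ∈ v := by
        refine List.exists_mem_of_ne_nil v ?_
        rintro rfl
        have := hp.length_eq
        simp at this
      rcases h with ⟨-, h⟩ | h
      · exact lt_asymm (h y hy) (hv y hy)
      · exact lt_irrefl _ (hv _ (mem_of_mem_rightToLeftMinima h))
    obtain ⟨i, rfl⟩ := Nat.exists_eq_succ_of_ne_zero ha0
    have hg : glue i.succ b u v' ∈ flatWords (i.succ + b + 1) := by
      rw [← he, hab]
      exact mem_coe.1 hw
    refine ⟨⟨(i, b), u, v'⟩, ?_, he.symm⟩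
    simp only [mem_coe, mem_sigma, HasAntidiagonal.mem_antidiagonal, mem_product]
    exact ⟨by omega, (glue_mem_flatWords ha0 hu' hv').1 hg⟩

/-- The words satisfy the recursion of the Motzkin paths: the greatest letter comes last in the
case of a level step. -/
lemma flatPoly_succ (m : ℕ) : flatPoly (m + 1) = motzkin m := by
  induction m using Nat.strong_induction_on with
  | _ m ih =>
    rcases m with _ | _ | m
    · rw [flatPoly_one, motzkin_zero]
    · rw [flatPoly_add_two, motzkin_one]
      simp [flatPoly_one]
    · rw [flatPoly_add_two, motzkin_add_two, Nat.antidiagonal_succ', sum_cons, sum_map]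
      simp only [if_true, Function.Embedding.prodMap, Function.Embedding.coeFn_mk, Prod.map_fst,
        Prod.map_snd, Function.Embedding.refl_apply, Nat.succ_ne_zero, if_false,
        ih (m + 1) (by omega), mul_comm Polynomial.X]
      congr 1
      refine sum_congr rfl fun p hp => ?_
      rw [HasAntidiagonal.mem_antidiagonal] at hp
      rw [ih p.1 (by omega), Nat.succ_eq_add_one, ih p.2 (by omega)]

/-! ### Counting the partitions -/

lemma finite_descentTerminators (w : List ℕ) : (descentTerminators w).Finite :=
  w.toFinset.finite_toSet.subset fun x hx => by
    simpa using mem_of_mem_descentTerminators hx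

/-- The number of ways to mark right-to-left minima of a word, all descent terminators included. -/
lemma card_markings {w : List ℕ} (h : descentTerminators w ⊆ rightToLeftMinima w) :
    #(Icc (finite_descentTerminators w).toFinset (finite_rightToLeftMinima w).toFinset) =
      2 ^ freeMinima w := by
  rw [card_Icc_finset (by simpa using h), freeMinima,
    Set.ncard_sdiff h (finite_descentTerminators w), Set.ncard_eq_toFinset_card _ (finite_rightToLeftMinima w),
    Set.ncard_eq_toFinset_card _ (finite_descentTerminators w)]

/-- A flattening `w` arises from as many partitions as its free minima have subsets. -/
lemma ncard_partitions (n : ℕ) (q : List ℕ → Prop) [DecidablePred q] :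
    {P : Finpartition (Icc 1 n) | Avoids231 (flatten P) ∧ q (flatten P)}.ncard =
      ∑ w ∈ flatWords n with q w, 2 ^ freeMinima w := by
  let f (P : Finpartition (Icc 1 n)) : Σ _ : List ℕ, Finset ℕ := ⟨flatten P, blockInitiators P⟩
  have hf : Function.Injective f := by
    intro P Q h
    apply flatten_blockInitiators_injective
    obtain ⟨h1, h2⟩ := Sigma.mk.inj h
    exact Prod.ext h1 (eq_of_heq h2)
  have himage : f '' {P | Avoids231 (flatten P) ∧ q (flatten P)} =
      ((flatWords n).filter q).sigma fun w =>
        Icc (finite_descentTerminators w).toFinset (finite_rightToLeftMinima w).toFinset := by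
    ext ⟨w, S⟩
    simp only [Set.mem_image, Set.mem_ofPred_eq, mem_coe, mem_sigma, mem_filter, mem_Icc,
      Set.Finite.toFinset_subset, Set.Finite.subset_toFinset, mem_flatWords]
    constructor
    · rintro ⟨P, ⟨ha, hq⟩, h⟩
      obtain ⟨rfl, h2⟩ := Sigma.mk.inj h
      obtain rfl := eq_of_heq h2
      have hd := descentTerminators_subset_blockInitiators P
      have hr := blockInitiators_subset_rightToLeftMinima P
      exact ⟨⟨⟨flatten_perm P, ha, hd.trans hr⟩, hq⟩, hd, hr⟩
    · rintro ⟨⟨⟨hp, ha, -⟩, hq⟩, hd, hr⟩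
      obtain ⟨P, rfl, rfl⟩ := exists_flatten_eq hp hd hr
      exact ⟨P, ⟨ha, hq⟩, rfl⟩
  rw [← Set.ncard_image_of_injective _ hf, himage, Set.ncard_coe_finset, card_sigma]
  exact sum_congr rfl fun w hw => card_markings (mem_flatWords.1 (mem_filter.1 hw).1).2.2

lemma ncard_refinedAvoiders (n k : ℕ) :
    (refinedAvoiders n k [2, 3, 1]).ncard = 2 ^ k * (flatPoly n).coeff k := by
  have h : refinedAvoiders n k [2, 3, 1] =
      {P | Avoids231 (flatten P) ∧ freeMinima (flatten P) = k} := by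
    ext P
    simp [refinedAvoiders, avoiders, not_containsPattern_iff, freeMinima, nonDescentMinima]
  rw [h, ncard_partitions n (freeMinima · = k), coeff_flatPoly]
  refine (sum_congr rfl fun w hw => by rw [(mem_filter.1 hw).2]).trans ?_
  rw [sum_const, smul_eq_mul, mul_comm]

lemma ncard_avoiders (n : ℕ) : (avoiders n [2, 3, 1]).ncard = (flatPoly n).eval 2 := by
  have h : avoiders n [2, 3, 1] = {P | Avoids231 (flatten P) ∧ True} := by
    ext P
    simp [avoiders, not_containsPattern_iff]
  rw [h, ncard_partitions n fun _ => True]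
  simp [flatPoly, Polynomial.eval_finsetSum]

end FlattenPartition

/-- In the first part the truncated difference `n - 1 - k` is harmless: it is the true one when
`k ≤ n - 1`, and the binomial coefficient vanishes when `k > n - 1`. -/
theorem mainTheorem1 :
    (∀ n k : ℕ, 1 ≤ n →
      (FlattenPartition.refinedAvoiders n k [2, 3, 1]).ncard =
        (n - 1).choose k * 2 ^ k * FlattenPartition.catalanHalf (n - 1 - k)) ∧
    (∀ n : ℕ, (FlattenPartition.avoiders n [2, 3, 1]).ncard = catalan n) := by
  constructor
  · intro n k hn
    obtain ⟨m, rfl⟩ := Nat.exists_eq_add_of_le' hn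
    rw [FlattenPartition.ncard_refinedAvoiders, FlattenPartition.flatPoly_succ,
      FlattenPartition.coeff_motzkin, Nat.add_sub_cancel]
    ring
  · intro n
    rw [FlattenPartition.ncard_avoiders]
    rcases n with _ | m
    · simp [FlattenPartition.flatPoly_zero]
    · rw [FlattenPartition.flatPoly_succ, FlattenPartition.eval_motzkin]
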